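/- Let $n\ge 1$, $\mathcal N=\{1,\dots,n\}$, and fix a base $b>1$ for logarithms. Let $\mathcal H_n=\mathbb R^{2^{\mathcal N}}$ with its Euclidean topology. Let $\Gamma^*_n\subset\mathcal H_n$ be the set of all entropy functions, that is, of all vectors $\mathbf h$ with $\mathbf h(\mathcal A)=H_b(X_{\mathcal A})$ for every $\mathcal A\subset\mathcal N$, where $X_1,\dots,X_n$ are discrete (countably valued) random variables on a common probability space with finite joint entropies, $X_{\mathcal A}=(X_i)_{i\in\mathcal A}$, $H_b(Y)=-\sum_y \Pr(Y=y)\log_b\Pr(Y=y)$ and $H_b(X_\emptyset)=0$. Let $\Gamma_n\subset\mathcal H_n$ be the set of all polymatroids, that is, of all $\mathbf h$ such that $\mathbf h(\emptyset)=0$, $\mathbf h(\mathcal A)\le\mathbf h(\mathcal B)$ whenever $\mathcal A\subset\mathcal B$, and $\mathbf h(\mathcal A)+\mathbf h(\mathcal B)\ge\mathbf h(\mathcal A\cap\mathcal B)+\mathbf h(\mathcal A\cup\mathcal B)$ for all $\mathcal A,\mathcal B\subset\mathcal N$. For a partition $p$ of $\mathcal N$ into nonempty blocks, let $S_p$ be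 the set of all $\mathbf h\in\mathcal H_n$ such that $\mathbf h(\mathcal A)=\mathbf h(\mathcal B)$ whenever $|\mathcal A\cap\mathcal P|=|\mathcal B\cap\mathcal P|$ for every block $\mathcal P$ of $p$. Let $\Psi^*_p=\Gamma^*_n\cap S_p$ and $\Psi_p=\Gamma_n\cap S_p$. For the 1-partition $p=\{\mathcal N\}$ write $S_n,\Psi^*_n,\Psi_n$; thus $S_n$ consists of the $\mathbf h$ for which $\mathbf h(\mathcal A)$ depends only on $|\mathcal A|$. Then $$\Psi_n=\overline{\Gamma^*_n}\cap S_n\qquad\text{and}\qquad \overline{\Psi^*_n}=\Psi_n .$$ -/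

import Mathlib

open MeasureTheory

/-- The entropy space of `n` random variables: real functions on the subsets of the index set
`Fin n`, with the product (i.e. Euclidean) topology. -/
abbrev EntropySpace (n : ℕ) : Type := Finset (Fin n) → ℝ

/-- Probability that `Y` takes the value `y`. -/
noncomputable def pointProb {Ω β : Type} [MeasurableSpace Ω] (μ : Measure Ω) (Y : Ω → β) (y : β) :
    ℝ :=
  μ.real (Y ⁻¹' {y})

/-- The discrete random variable `Y` has finite Shannon entropy in base `b`. -/
def HasFiniteEntropy {Ω β : Type} [MeasurableSpace Ω] (b : ℝ) (μ : Measure Ω) (Y : Ω → β) : Prop :=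
  Summable fun y => -(pointProb μ Y y * Real.logb b (pointProb μ Y y))

/-- The Shannon entropy `-∑ P(Y = y) log_b P(Y = y)` of a discrete random variable `Y`. -/
noncomputable def shannonEntropy {Ω β : Type} [MeasurableSpace Ω] (b : ℝ) (μ : Measure Ω)
    (Y : Ω → β) : ℝ :=
  ∑' y, -(pointProb μ Y y * Real.logb b (pointProb μ Y y))

/-- The joint random variable `X_A = (X i)_{i ∈ A}`. For `A = ∅` it takes a single value. -/
def jointVar {n : ℕ} {Ω : Type} {α : Fin n → Type} (X : ∀ i, Ω → α i) (A : Finset (Fin n)) :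
    Ω → ∀ i : A, α i :=
  fun ω i => X i ω

/-- The entropy function region `Γ*_n`, entropy being measured in base `b`: the vectors
`A ↦ H(X_A)` for discrete (countably valued) random variables `X_1, …, X_n` on a common
probability space, all of whose joint entropies are finite. -/
def entropyRegion (b : ℝ) (n : ℕ) : Set (EntropySpace n) :=
  {h | ∃ (Ω : Type) (_ : MeasurableSpace Ω) (μ : Measure Ω) (_ : IsProbabilityMeasure μ)
      (α : Fin n → Type) (_ : ∀ i, Countable (α i)) (_ : ∀ i, MeasurableSpace (α i))
      (_ : ∀ i, DiscreteMeasurableSpace (α i)) (X : ∀ i, Ω → α i),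
      (∀ i, Measurable (X i)) ∧
      ∀ A : Finset (Fin n), HasFiniteEntropy b μ (jointVar X A) ∧
        h A = shannonEntropy b μ (jointVar X A)}

/-- The polymatroidal region `Γ_n`. -/
def polymatroidRegion (n : ℕ) : Set (EntropySpace n) :=
  {h | h ∅ = 0 ∧ (∀ A B : Finset (Fin n), A ⊆ B → h A ≤ h B) ∧
    ∀ A B : Finset (Fin n), h (A ∩ B) + h (A ∪ B) ≤ h A + h B}

/-- The `p`-symmetrical subspace `S_p`, for a partition `p` of the index set: `h A` depends only
on the numbers of elements that `A` has in the blocks of `p`. -/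
def symmetricSubspace {n : ℕ} (p : Finpartition (Finset.univ : Finset (Fin n))) :
    Set (EntropySpace n) :=
  {h | ∀ A B : Finset (Fin n), (∀ P ∈ p.parts, (A ∩ P).card = (B ∩ P).card) → h A = h B}

/-- The `p`-symmetrical entropy function region `Ψ*_p`. -/
def symEntropyRegion (b : ℝ) {n : ℕ} (p : Finpartition (Finset.univ : Finset (Fin n))) :
    Set (EntropySpace n) :=
  entropyRegion b n ∩ symmetricSubspace p

/-- The `p`-symmetrical polymatroidal region `Ψ_p`. -/
def symPolymatroidRegion {n : ℕ} (p : Finpartition (Finset.univ : Finset (Fin n))) :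
    Set (EntropySpace n) :=
  polymatroidRegion n ∩ symmetricSubspace p

/-! Entropy functions are polymatroids by Shannon's inequalities, and both the polymatroids and the
symmetric vectors form closed sets. All inclusions then follow once every symmetric polymatroid is a
limit of symmetric entropy functions. A symmetric polymatroid `h` depends on `|A|` through a
nondecreasing concave function, so it is a combination of the uniform ranks `min |A| m` with
coefficients `c_m ≥ 0` (`exists_uniform_decomposition`). Evaluating a random polynomial of degree `<
m` over a field with `q` elements at distinct points gives entropy `min |A| m * log q`. Choose `m`
at random with probability `c_m / log q`, put the remaining mass on `m = 0`, and let each variable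
also reveal `m`: for nonempty `A` the entropy is `h A` plus the entropy of the choice
(`mixture_mem_entropyRegion`). That excess tends to 0 as `q → ∞`. -/

open MeasureTheory Filter Topology

/-- The probability of the value that `Y` takes at `ω`. -/
noncomputable def atomProb {Ω β : Type} [MeasurableSpace Ω] (μ : Measure Ω) (Y : Ω → β) (ω : Ω) :
    ℝ :=
  pointProb μ Y (Y ω)

/-! ### Shannon's inequalities for countably valued variables -/

section Entropy

variable {Ω β γ δ ε : Type} [MeasurableSpace Ω] {μ : Measure Ω}

theorem lintegral_comp_eq_tsum [Countable β] [MeasurableSpace β] [MeasurableSingletonClass β]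
    {Y : Ω → β} (hY : Measurable Y) (φ : β → ENNReal) :
    ∫⁻ ω, φ (Y ω) ∂μ = ∑' y, φ y * μ (Y ⁻¹' {y}) := by
  rw [← lintegral_map (measurable_of_countable φ) hY, lintegral_countable']
  simp_rw [Measure.map_apply hY (measurableSet_singleton _)]

theorem atomProb_congr {Y : Ω → β} {Z : Ω → γ} (h : ∀ ω ω', Y ω = Y ω' ↔ Z ω = Z ω') :
    atomProb μ Y = atomProb μ Z := by
  funext ω
  simp only [atomProb, pointProb]
  congr 1
  ext ω'
  exact h ω' ω

theorem atomProb_nonneg (Y : Ω → β) (ω : Ω) : 0 ≤ atomProb μ Y ω := measureReal_nonneg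

theorem measurable_atomProb [Countable β] [MeasurableSpace β] [MeasurableSingletonClass β]
    {Y : Ω → β} (hY : Measurable Y) : Measurable (atomProb μ Y) :=
  (measurable_of_countable (pointProb μ Y)).comp hY

variable [IsProbabilityMeasure μ]

theorem atomProb_le_one (Y : Ω → β) (ω : Ω) : atomProb μ Y ω ≤ 1 := measureReal_le_one

theorem atomProb_mono {Y : Ω → β} {Z : Ω → γ} (h : ∀ ω ω', Z ω = Z ω' → Y ω = Y ω') (ω : Ω) :
    atomProb μ Z ω ≤ atomProb μ Y ω :=
  measureReal_mono fun ω' hω' => h ω' ω hω'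

theorem atomProb_pos_ae [Countable β] (Y : Ω → β) : ∀ᵐ ω ∂μ, 0 < atomProb μ Y ω := by
  have h : ∀ᵐ ω ∂μ, μ (Y ⁻¹' {Y ω}) ≠ 0 := by
    rw [ae_iff]
    simp only [ne_eq, not_not]
    have hset : {ω | μ (Y ⁻¹' {Y ω}) = 0} = ⋃ y ∈ {y | μ (Y ⁻¹' {y}) = 0}, Y ⁻¹' {y} := by
      ext ω
      simp
    rw [hset, measure_biUnion_null_iff (Set.to_countable _)]
    exact fun y hy => hy
  filter_upwards [h] with ω hω
  exact ENNReal.toReal_pos hω (measure_ne_top _ _)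

theorem lintegral_neg_logb_atomProb [Countable β] [MeasurableSpace β] [MeasurableSingletonClass β]
    {b : ℝ} {Y : Ω → β} (hY : Measurable Y) :
    ∫⁻ ω, ENNReal.ofReal (-Real.logb b (atomProb μ Y ω)) ∂μ =
      ∑' y, ENNReal.ofReal (-(pointProb μ Y y * Real.logb b (pointProb μ Y y))) := by
  refine (lintegral_comp_eq_tsum (μ := μ) hY
    (fun y => ENNReal.ofReal (-Real.logb b (pointProb μ Y y)))).trans ?_
  refine tsum_congr fun y => ?_
  rw [← ofReal_measureReal (measure_ne_top _ _), mul_comm, ← ENNReal.ofReal_mul measureReal_nonneg]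
  congr 1
  simp [pointProb]

theorem neg_logb_atomProb_nonneg {b : ℝ} (hb : 1 < b) (Y : Ω → β) (ω : Ω) :
    0 ≤ -Real.logb b (atomProb μ Y ω) :=
  neg_nonneg.2 (Real.logb_nonpos hb (atomProb_nonneg Y ω) (atomProb_le_one Y ω))

theorem entropy_summand_nonneg {b : ℝ} (hb : 1 < b) (Y : Ω → β) (y : β) :
    0 ≤ -(pointProb μ Y y * Real.logb b (pointProb μ Y y)) :=
  neg_nonneg.2 (mul_nonpos_of_nonneg_of_nonpos measureReal_nonneg
    (Real.logb_nonpos hb measureReal_nonneg measureReal_le_one))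

theorem integrable_logb_atomProb [Countable β] [MeasurableSpace β] [MeasurableSingletonClass β]
    {b : ℝ} (hb : 1 < b) {Y : Ω → β} (hY : Measurable Y) (h : HasFiniteEntropy b μ Y) :
    Integrable (fun ω => Real.logb b (atomProb μ Y ω)) μ := by
  have hm : Measurable fun ω => -Real.logb b (atomProb μ Y ω) :=
    ((Real.measurable_log.comp (measurable_atomProb hY)).div_const _).neg
  have h1 := lintegral_ofReal_ne_top_iff_integrable hm.aestronglyMeasurable
    (ae_of_all μ (neg_logb_atomProb_nonneg hb Y))
  rw [lintegral_neg_logb_atomProb hY,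
    ← ENNReal.ofReal_tsum_of_nonneg (entropy_summand_nonneg hb Y) h] at h1
  simpa using (h1.1 ENNReal.ofReal_ne_top).neg

/-- Entropies of different variables become integrals over one space, so Shannon's inequalities
reduce to pointwise estimates under the integral. -/
theorem shannonEntropy_eq_neg_integral [Countable β] [MeasurableSpace β]
    [MeasurableSingletonClass β] {b : ℝ} (hb : 1 < b) {Y : Ω → β} (hY : Measurable Y)
    (h : HasFiniteEntropy b μ Y) :
    shannonEntropy b μ Y = -∫ ω, Real.logb b (atomProb μ Y ω) ∂μ := by
  rw [← integral_neg, integral_eq_lintegral_of_nonneg_ae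
    (ae_of_all μ (neg_logb_atomProb_nonneg hb Y))
    (integrable_logb_atomProb hb hY h).neg.aestronglyMeasurable,
    lintegral_neg_logb_atomProb hY,
    ← ENNReal.ofReal_tsum_of_nonneg (entropy_summand_nonneg hb Y) h,
    ENNReal.toReal_ofReal (tsum_nonneg (entropy_summand_nonneg hb Y))]
  rfl

/-- The ratio compares the true law of `(Y, Z)` with the law making `Y` and `Z` conditionally
independent given `D`; its mean is the mass the latter puts on the support of the former. -/
theorem lintegral_likelihood_ratio_le_one
    [Countable β] [MeasurableSpace β] [MeasurableSingletonClass β]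
    [Countable γ] [MeasurableSpace γ] [MeasurableSingletonClass γ]
    {Y : Ω → β} {Z : Ω → γ} (hY : Measurable Y) (hZ : Measurable Z) {D : Ω → δ}
    (f : β → δ) (g : γ → δ) (hf : ∀ ω, f (Y ω) = D ω) (hg : ∀ ω, g (Z ω) = D ω) :
    ∫⁻ ω, (μ (Y ⁻¹' {Y ω}) * μ (Z ⁻¹' {Z ω})) /
      (μ ((fun ω => (Y ω, Z ω)) ⁻¹' {(Y ω, Z ω)}) * μ (D ⁻¹' {D ω})) ∂μ ≤ 1 := by
  classical
  have hsum (d : δ) : ∑' z, (if g z = d then 1 else 0) * μ (Z ⁻¹' {z}) = μ (D ⁻¹' {d}) := by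
    rw [← lintegral_comp_eq_tsum hZ (fun z => if g z = d then (1 : ENNReal) else 0)]
    have hs : MeasurableSet (D ⁻¹' {d}) := by
      have : D ⁻¹' {d} = Z ⁻¹' (g ⁻¹' {d}) := by ext ω; simp [hg]
      rw [this]
      exact hZ (Set.to_countable _).measurableSet
    rw [← lintegral_indicator_one hs]
    refine lintegral_congr fun ω => ?_
    simp [Set.indicator, hg]
  calc ∫⁻ ω, (μ (Y ⁻¹' {Y ω}) * μ (Z ⁻¹' {Z ω})) /
      (μ ((fun ω => (Y ω, Z ω)) ⁻¹' {(Y ω, Z ω)}) * μ (D ⁻¹' {D ω})) ∂μ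
      = ∑' w : β × γ, (μ (Y ⁻¹' {w.1}) * μ (Z ⁻¹' {w.2})) /
        (μ ((fun ω => (Y ω, Z ω)) ⁻¹' {w}) * μ (D ⁻¹' {f w.1})) *
          μ ((fun ω => (Y ω, Z ω)) ⁻¹' {w}) := by
        rw [← lintegral_comp_eq_tsum (hY.prodMk hZ) (fun w : β × γ =>
          (μ (Y ⁻¹' {w.1}) * μ (Z ⁻¹' {w.2})) /
          (μ ((fun ω => (Y ω, Z ω)) ⁻¹' {w}) * μ (D ⁻¹' {f w.1})))]
        simp only [hf]
    -- A pair of positive mass has `g w.2 = f w.1`, so the indicator costs nothing; it lets the sum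
    -- over the second coordinate collapse to the mass of `D`.
    _ ≤ ∑' w : β × γ, μ (Y ⁻¹' {w.1}) / μ (D ⁻¹' {f w.1}) *
        ((if g w.2 = f w.1 then 1 else 0) * μ (Z ⁻¹' {w.2})) := by
        refine ENNReal.tsum_le_tsum fun w => ?_
        by_cases hw : μ ((fun ω => (Y ω, Z ω)) ⁻¹' {w}) = 0
        · simp [hw]
        have hgw : g w.2 = f w.1 := by
          obtain ⟨ω, hω⟩ := nonempty_of_measure_ne_zero hw
          have hω' : (Y ω, Z ω) = w := hω
          rw [← hω', hf, hg]
        rw [if_pos hgw, one_mul]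
        have hw' := measure_ne_top μ ((fun ω => (Y ω, Z ω)) ⁻¹' {w})
        rw [ENNReal.div_eq_inv_mul, ENNReal.mul_inv (Or.inl hw) (Or.inl hw'), ENNReal.div_eq_inv_mul]
        set c := μ ((fun ω => (Y ω, Z ω)) ⁻¹' {w})
        calc _ = (c⁻¹ * c) * ((μ (D ⁻¹' {f w.1}))⁻¹ * μ (Y ⁻¹' {w.1}) * μ (Z ⁻¹' {w.2})) := by ring
          _ ≤ _ := by rw [ENNReal.inv_mul_cancel hw hw', one_mul]
    _ = ∑' y, μ (Y ⁻¹' {y}) / μ (D ⁻¹' {f y}) * μ (D ⁻¹' {f y}) := by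
        rw [ENNReal.tsum_prod']
        refine tsum_congr fun y => ?_
        dsimp only
        rw [ENNReal.tsum_mul_left, hsum]
    _ ≤ ∑' y, 1 * μ (Y ⁻¹' {y}) := by
        refine ENNReal.tsum_le_tsum fun y => ?_
        rw [one_mul]
        exact ENNReal.mul_le_of_le_div le_rfl
    _ = 1 := by
        rw [← lintegral_comp_eq_tsum hY (fun _ => 1)]
        simp

/-- Shannon's basic inequality `H(Y) + H(Z) ≥ H(Y, Z) + H(D)` for `D` a common function of
`Y` and `Z`. -/
theorem shannonEntropy_submodular
    [Countable β] [MeasurableSpace β] [MeasurableSingletonClass β]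
    [Countable γ] [MeasurableSpace γ] [MeasurableSingletonClass γ]
    [Countable δ] [MeasurableSpace δ] [MeasurableSingletonClass δ]
    [Countable ε] [MeasurableSpace ε] [MeasurableSingletonClass ε]
    {b : ℝ} (hb : 1 < b) {Y : Ω → β} {Z : Ω → γ} {D : Ω → δ} {W : Ω → ε}
    (hY : Measurable Y) (hZ : Measurable Z) (hD : Measurable D) (hW : Measurable W)
    (f : β → δ) (g : γ → δ) (hf : ∀ ω, f (Y ω) = D ω) (hg : ∀ ω, g (Z ω) = D ω)
    (hYZ : ∀ ω ω', W ω = W ω' ↔ Y ω = Y ω' ∧ Z ω = Z ω')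
    (eY : HasFiniteEntropy b μ Y) (eZ : HasFiniteEntropy b μ Z) (eD : HasFiniteEntropy b μ D)
    (eW : HasFiniteEntropy b μ W) :
    shannonEntropy b μ D + shannonEntropy b μ W ≤ shannonEntropy b μ Y + shannonEntropy b μ Z := by
  have iY := integrable_logb_atomProb hb hY eY
  have iZ := integrable_logb_atomProb hb hZ eZ
  have iD := integrable_logb_atomProb hb hD eD
  have iW := integrable_logb_atomProb hb hW eW
  rw [shannonEntropy_eq_neg_integral hb hY eY, shannonEntropy_eq_neg_integral hb hZ eZ,
    shannonEntropy_eq_neg_integral hb hD eD, shannonEntropy_eq_neg_integral hb hW eW]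
  have hWV : atomProb μ W = atomProb μ (fun ω => (Y ω, Z ω)) :=
    atomProb_congr fun ω ω' => by simp [hYZ]
  have hle := lintegral_likelihood_ratio_le_one (μ := μ) hY hZ f g hf hg
  set φ : Ω → ENNReal := fun ω => (μ (Y ⁻¹' {Y ω}) * μ (Z ⁻¹' {Z ω})) /
      (μ ((fun ω => (Y ω, Z ω)) ⁻¹' {(Y ω, Z ω)}) * μ (D ⁻¹' {D ω})) with hφ
  have hφm : Measurable φ := by
    have hs {κ : Type} [Countable κ] [MeasurableSpace κ] [MeasurableSingletonClass κ] {V : Ω → κ}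
        (hV : Measurable V) : Measurable fun ω => μ (V ⁻¹' {V ω}) :=
      (measurable_of_countable fun v => μ (V ⁻¹' {v})).comp hV
    exact ((hs hY).mul (hs hZ)).div ((hs (hY.prodMk hZ)).mul (hs hD))
  have hφr (ω : Ω) : (φ ω).toReal = atomProb μ Y ω * atomProb μ Z ω /
      (atomProb μ W ω * atomProb μ D ω) := by
    rw [hWV, hφ]
    simp only [ENNReal.toReal_div, ENNReal.toReal_mul]
    rfl
  have hφt : ∫⁻ ω, φ ω ∂μ ≠ ⊤ := (hle.trans_lt ENNReal.one_lt_top).ne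
  have hφi := integrable_toReal_of_lintegral_ne_top hφm.aemeasurable hφt
  have hφ1 : ∫ ω, (φ ω).toReal ∂μ ≤ 1 := by
    rw [integral_toReal hφm.aemeasurable (ae_lt_top hφm hφt)]
    exact ENNReal.toReal_mono ENNReal.one_ne_top hle
  -- This is `log x ≤ x - 1` at the likelihood ratio, which is positive almost everywhere.
  have key : ∫ ω, (Real.logb b (atomProb μ Y ω) + Real.logb b (atomProb μ Z ω) -
      (Real.logb b (atomProb μ W ω) + Real.logb b (atomProb μ D ω))) ∂μ ≤
      ∫ ω, ((φ ω).toReal - 1) / Real.log b ∂μ := by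
    refine integral_mono_ae ((iY.add iZ).sub (iW.add iD))
      ((hφi.sub (integrable_const 1)).div_const _) ?_
    filter_upwards [atomProb_pos_ae (μ := μ) Y, atomProb_pos_ae (μ := μ) Z,
      atomProb_pos_ae (μ := μ) D, atomProb_pos_ae (μ := μ) W] with ω pY pZ pD pW
    rw [← Real.logb_mul pY.ne' pZ.ne', ← Real.logb_mul pW.ne' pD.ne',
      ← Real.logb_div (by positivity) (by positivity), hφr]
    exact div_le_div_of_nonneg_right (Real.log_le_sub_one_of_pos (by positivity))
      (Real.log_pos hb).le
  have h0 : ∫ ω, ((φ ω).toReal - 1) / Real.log b ∂μ ≤ 0 := by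
    rw [integral_div, integral_sub hφi (integrable_const 1)]
    refine div_nonpos_of_nonpos_of_nonneg ?_ (Real.log_pos hb).le
    simpa using hφ1
  have hsplit := integral_sub (iY.add iZ) (iW.add iD)
  have h1 := integral_add iY iZ
  have h2 := integral_add iW iD
  simp only [Pi.add_apply] at hsplit
  linarith

theorem shannonEntropy_mono
    [Countable β] [MeasurableSpace β] [MeasurableSingletonClass β]
    [Countable γ] [MeasurableSpace γ] [MeasurableSingletonClass γ]
    {b : ℝ} (hb : 1 < b) {Y : Ω → β} {Z : Ω → γ} (hY : Measurable Y) (hZ : Measurable Z)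
    (h : ∀ ω ω', Z ω = Z ω' → Y ω = Y ω')
    (eY : HasFiniteEntropy b μ Y) (eZ : HasFiniteEntropy b μ Z) :
    shannonEntropy b μ Y ≤ shannonEntropy b μ Z := by
  rw [shannonEntropy_eq_neg_integral hb hY eY, shannonEntropy_eq_neg_integral hb hZ eZ,
    neg_le_neg_iff]
  refine integral_mono_ae (integrable_logb_atomProb hb hZ eZ) (integrable_logb_atomProb hb hY eY) ?_
  filter_upwards [atomProb_pos_ae (μ := μ) Z] with ω hω
  exact Real.logb_le_logb_of_le hb hω (atomProb_mono h ω)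

end Entropy

/-! ### Entropy functions as polymatroids, and closedness -/

theorem jointVar_eq_iff {n : ℕ} {Ω : Type} {α : Fin n → Type} (X : ∀ i, Ω → α i)
    (A : Finset (Fin n)) (ω ω' : Ω) :
    jointVar X A ω = jointVar X A ω' ↔ ∀ i ∈ A, X i ω = X i ω' := by
  simp [funext_iff, jointVar]

theorem entropyRegion_subset_polymatroidRegion {b : ℝ} (hb : 1 < b) (n : ℕ) :
    entropyRegion b n ⊆ polymatroidRegion n := by
  rintro h ⟨Ω, _, μ, _, α, _, _, _, X, hX, hA⟩
  have hm (A : Finset (Fin n)) : Measurable (jointVar X A) :=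
    measurable_pi_lambda _ fun i => hX i
  refine ⟨?_, fun A B hAB => ?_, fun A B => ?_⟩
  · rw [(hA ∅).2, shannonEntropy_eq_neg_integral hb (hm ∅) (hA ∅).1]
    have : atomProb μ (jointVar X ∅) = fun _ => 1 := by
      funext ω
      have : jointVar X ∅ ⁻¹' {jointVar X ∅ ω} = Set.univ := by
        ext ω'
        simp [jointVar_eq_iff]
      simp [atomProb, pointProb, this]
    simp [this]
  · rw [(hA A).2, (hA B).2]
    refine shannonEntropy_mono hb (hm A) (hm B) (fun ω ω' => ?_) (hA A).1 (hA B).1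
    simp only [jointVar_eq_iff]
    exact fun h i hi => h i (hAB hi)
  · rw [(hA A).2, (hA B).2, (hA (A ∩ B)).2, (hA (A ∪ B)).2]
    refine shannonEntropy_submodular hb (hm A) (hm B) (hm _) (hm _)
      (fun x i => x ⟨i, (Finset.mem_inter.1 i.2).1⟩) (fun x i => x ⟨i, (Finset.mem_inter.1 i.2).2⟩)
      (fun _ => rfl) (fun _ => rfl) (fun ω ω' => ?_) (hA A).1 (hA B).1 (hA _).1 (hA _).1
    simp only [jointVar_eq_iff, Finset.mem_union]
    exact ⟨fun h => ⟨fun i hi => h i (Or.inl hi), fun i hi => h i (Or.inr hi)⟩,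
      fun h i hi => hi.elim (h.1 i) (h.2 i)⟩

theorem isClosed_polymatroidRegion (n : ℕ) : IsClosed (polymatroidRegion n) := by
  simp only [polymatroidRegion, Set.ofPred_and, Set.ofPred_forall]
  refine IsClosed.inter (isClosed_eq (continuous_apply _) continuous_const) (IsClosed.inter ?_ ?_)
  · exact isClosed_iInter fun A => isClosed_iInter fun B => isClosed_iInter fun _ =>
      isClosed_le (continuous_apply _) (continuous_apply _)
  · exact isClosed_iInter fun A => isClosed_iInter fun B =>
      isClosed_le (by fun_prop) (by fun_prop)

theorem isClosed_symmetricSubspace {n : ℕ} (p : Finpartition (Finset.univ : Finset (Fin n))) :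
    IsClosed (symmetricSubspace p) := by
  simp only [symmetricSubspace, Set.ofPred_forall]
  exact isClosed_iInter fun A => isClosed_iInter fun B => isClosed_iInter fun _ =>
    isClosed_eq (continuous_apply _) (continuous_apply _)

/-! ### Finite models and mixtures of Reed-Solomon codes -/

theorem mem_entropyRegion_of_weights {n : ℕ} {b : ℝ} (hb : 1 < b) {Ω : Type} [Fintype Ω]
    (w : Ω → ℝ) (hw0 : ∀ ω, 0 ≤ w ω) (hw1 : ∑ ω, w ω = 1) {α : Fin n → Type} [∀ i, Finite (α i)]
    [∀ i, DecidableEq (α i)] (X : ∀ i, Ω → α i) :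
    (fun A : Finset (Fin n) => -∑ ω, w ω *
      Real.logb b (∑ ω', if ∀ i ∈ A, X i ω' = X i ω then w ω' else 0)) ∈ entropyRegion b n := by
  classical
  let : MeasurableSpace Ω := ⊤
  let (i : Fin n) : MeasurableSpace (α i) := ⊤
  let P : PMF Ω := PMF.ofFintype (fun ω => ENNReal.ofReal (w ω)) (by
    rw [← ENNReal.ofReal_sum_of_nonneg fun ω _ => hw0 ω, hw1, ENNReal.ofReal_one])
  have hP (ω : Ω) : (P ω).toReal = w ω := ENNReal.toReal_ofReal (hw0 ω)
  have hfin (A : Finset (Fin n)) : HasFiniteEntropy b P.toMeasure (jointVar X A) :=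
    summable_of_hasFiniteSupport (Set.toFinite _)
  refine ⟨Ω, inferInstance, P.toMeasure, inferInstance, α, inferInstance, inferInstance,
    fun i => ⟨fun _ => trivial⟩, X, fun i => measurable_from_top, fun A => ⟨hfin A, ?_⟩⟩
  rw [shannonEntropy_eq_neg_integral hb measurable_from_top (hfin A), PMF.integral_eq_sum]
  refine congrArg Neg.neg ?_
  refine Finset.sum_congr rfl fun ω _ => ?_
  rw [hP, smul_eq_mul, atomProb, pointProb, Measure.real, PMF.toMeasure_apply_fintype,
    ENNReal.toReal_sum fun ω' _ => ?_]
  · congr 2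
    refine Finset.sum_congr rfl fun ω' _ => ?_
    simp only [Set.indicator, Set.mem_preimage, Set.mem_singleton_iff, jointVar_eq_iff]
    split_ifs <;> simp [hP]
  · exact ne_top_of_le_ne_top (P.apply_ne_top ω') (Set.indicator_le_self _ _ _)

/-- Evaluation of the polynomials of degree less than `m` at a finite family of points. -/
noncomputable def evalOn (F : Type) [Field F] (m : ℕ) {ι : Type} (v : ι → F) :
    Polynomial.degreeLT F m →ₗ[F] (ι → F) :=
  LinearMap.pi fun i => (Polynomial.leval (v i)).comp (Polynomial.degreeLT F m).subtype

theorem evalOn_apply {F : Type} [Field F] {m : ℕ} {ι : Type} (v : ι → F)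
    (a : Polynomial.degreeLT F m) (i : ι) : evalOn F m v a i = (a : Polynomial F).eval (v i) := rfl

/-- With at least `m` points, evaluation is injective by counting roots; with at most `m`, it is
surjective by Lagrange interpolation. Hence the code realizes a uniform matroid. -/
theorem finrank_range_evalOn {F : Type} [Field F] (m : ℕ) {ι : Type} [Fintype ι] {v : ι → F}
    (hv : Function.Injective v) :
    Module.finrank F (LinearMap.range (evalOn F m v)) = min (Fintype.card ι) m := by
  classical
  have hdim : Module.finrank F (Polynomial.degreeLT F m) = m := by
    rw [(Polynomial.degreeLTEquiv F m).finrank_eq]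
    simp
  rcases le_total m (Fintype.card ι) with h | h
  · rw [min_eq_right h, LinearMap.finrank_range_of_inj, hdim]
    rw [← LinearMap.ker_eq_bot, LinearMap.ker_eq_bot']
    intro a ha
    refine Subtype.ext (Polynomial.eq_zero_of_degree_lt_of_eval_index_eq_zero (v := v)
      (s := Finset.univ) hv.injOn ?_ fun i _ => ?_)
    · exact (Polynomial.mem_degreeLT.1 a.2).trans_le (by exact_mod_cast h)
    · exact congrFun ha i
  · rw [min_eq_left h, LinearMap.range_eq_top.2, finrank_top, Module.finrank_fintype_fun_eq_card]
    intro r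
    refine ⟨⟨Lagrange.interpolate Finset.univ v r, Polynomial.mem_degreeLT.2 ?_⟩, ?_⟩
    · exact (Lagrange.degree_interpolate_lt r hv.injOn).trans_le (by exact_mod_cast h)
    · funext i
      exact Lagrange.eval_interpolate_at_node r hv.injOn (Finset.mem_univ i)

theorem finite_degreeLT (F : Type) [Field F] [Finite F] (m : ℕ) :
    Finite (Polynomial.degreeLT F m) :=
  Finite.of_equiv _ (Polynomial.degreeLTEquiv F m).symm.toEquiv

/-- Fibres are cosets of the kernel, so this is rank-nullity in cardinalities. -/
theorem card_fiber_linearMap {F V W : Type} [Field F] [Finite F] [AddCommGroup V] [Module F V]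
    [Finite V] [AddCommGroup W] [Module F W] (L : V →ₗ[F] W) (a : V) :
    Nat.card {x // L x = L a} * Nat.card F ^ Module.finrank F (LinearMap.range L) =
      Nat.card V := by
  have e : {x // L x = L a} ≃ LinearMap.ker L :=
    (Equiv.subRight a).subtypeEquiv fun x => by
      simp [LinearMap.mem_ker, sub_eq_zero]
  rw [Nat.card_congr e, Module.natCard_eq_pow_finrank (K := F), ← pow_add, add_comm,
    LinearMap.finrank_range_add_finrank_ker, ← Module.natCard_eq_pow_finrank]

/-- A mixture, with weights `δ`, of Reed-Solomon codes of dimensions `0, …, n` over a field with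
`p` elements. -/
theorem mixture_mem_entropyRegion {n p : ℕ} [Fact p.Prime] (hpn : n ≤ p) {b : ℝ} (hb : 1 < b)
    (δ : Fin (n + 1) → ℝ) (hδ0 : ∀ m, 0 ≤ δ m) (hδ1 : ∑ m, δ m = 1) :
    (fun A : Finset (Fin n) => if A = ∅ then 0 else
      ∑ m : Fin (n + 1), δ m * (min A.card (m : ℕ) * Real.logb b p - Real.logb b (δ m))) ∈
        entropyRegion b n := by
  classical
  have hp : 0 < (p : ℝ) := by exact_mod_cast (Fact.out : p.Prime).pos
  let F := ZMod p
  have (m : ℕ) : Finite (Polynomial.degreeLT F m) := finite_degreeLT F m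
  let (m : ℕ) : Fintype (Polynomial.degreeLT F m) := Fintype.ofFinite _
  have hcard (m : ℕ) : Fintype.card (Polynomial.degreeLT F m) = p ^ m := by
    rw [← Nat.card_eq_fintype_card, Nat.card_congr (Polynomial.degreeLTEquiv F m).toEquiv]
    simp [F]
  let x : Fin n → F := fun i => ((i : ℕ) : F)
  have hx : Function.Injective x := fun i j hij => Fin.ext <| by
    have := (ZMod.natCast_eq_natCast_iff' _ _ _).1 hij
    rwa [Nat.mod_eq_of_lt (i.2.trans_le hpn), Nat.mod_eq_of_lt (j.2.trans_le hpn)] at this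
  -- Given `m`, the polynomial is uniform among the `p ^ m` of degree `< m`.
  let w : (Σ m : Fin (n + 1), Polynomial.degreeLT F m) → ℝ := fun ω => δ ω.1 / (p : ℝ) ^ (ω.1 : ℕ)
  have hsum (G : Fin (n + 1) → ℝ) :
      ∑ ω : (Σ m : Fin (n + 1), Polynomial.degreeLT F m), w ω * G ω.1 = ∑ m, δ m * G m := by
    rw [Fintype.sum_sigma]
    refine Finset.sum_congr rfl fun m _ => ?_
    simp only [w, Finset.sum_const, Finset.card_univ, hcard, nsmul_eq_mul]
    push_cast
    field_simp
  have hw1 : ∑ ω, w ω = 1 := by simpa [hδ1] using hsum fun _ => 1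
  have key := mem_entropyRegion_of_weights (n := n) hb w (fun ω => div_nonneg (hδ0 _) (by positivity))
    hw1 (α := fun _ => Fin (n + 1) × F) (fun i ω => (ω.1, (ω.2 : Polynomial F).eval (x i)))
  convert key using 1
  funext A
  split_ifs with hA
  · simp [hA, hw1]
  obtain ⟨i₀, hi₀⟩ := Finset.nonempty_iff_ne_empty.2 hA
  have hfib (ω : Σ m : Fin (n + 1), Polynomial.degreeLT F m) :
      (∑ ω' : (Σ m : Fin (n + 1), Polynomial.degreeLT F m), if ∀ i ∈ A,
        (ω'.1, (ω'.2 : Polynomial F).eval (x i)) = (ω.1, (ω.2 : Polynomial F).eval (x i))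
        then w ω' else 0) = δ ω.1 / (p : ℝ) ^ min A.card (ω.1 : ℕ) := by
    obtain ⟨m, a⟩ := ω
    -- Since `A` is nonempty, some variable reveals `m`, so the fibre stays within one code.
    rw [Fintype.sum_sigma, Finset.sum_eq_single m]
    · have h1 := card_fiber_linearMap (evalOn F m fun i : A => x i) a
      rw [finrank_range_evalOn (v := fun i : A => x i) _ (hx.comp Subtype.val_injective), Nat.card_eq_fintype_card,
        Nat.card_eq_fintype_card, Nat.card_eq_fintype_card, hcard, ZMod.card,
        Fintype.card_coe, Fintype.card_subtype] at h1
      have h2 : (Finset.univ.filter fun a' : Polynomial.degreeLT F m => ∀ i ∈ A,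
          (m, (a' : Polynomial F).eval (x i)) = (m, (a : Polynomial F).eval (x i))) =
          Finset.univ.filter fun a' => evalOn F m (fun i : A => x i) a' =
            evalOn F m (fun i : A => x i) a := by
        ext a'
        simp [funext_iff, evalOn_apply]
      simp only [w]
      rw [← Finset.sum_filter, Finset.sum_const, h2, nsmul_eq_mul]
      have h3 := congrArg (Nat.cast : ℕ → ℝ) h1
      push_cast at h3
      rw [← h3]
      have : (0 : ℝ) < p ^ (m : ℕ) := by positivity
      rw [← h3] at this
      have h4 := (pos_of_mul_pos_left this (by positivity)).ne'
      field_simp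
    · intro m' _ hm'
      refine Finset.sum_eq_zero fun a' _ => if_neg fun h => hm' ?_
      exact congrArg Prod.fst (h i₀ hi₀)
    · simp
  simp only [hfib]
  rw [hsum fun m => Real.logb b (δ m / (p : ℝ) ^ min A.card (m : ℕ)), ← Finset.sum_neg_distrib]
  refine Finset.sum_congr rfl fun m _ => ?_
  rcases (hδ0 m).eq_or_lt with h | h
  · simp [← h]
  · rw [Real.logb_div h.ne' (by positivity), Real.logb_pow]
    push_cast
    ring

/-! ### Symmetric polymatroids and uniform matroids -/

theorem mem_symmetricSubspace_iff {n : ℕ} {p : Finpartition (Finset.univ : Finset (Fin n))}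
    (hp : p.parts.card = 1) {h : EntropySpace n} :
    h ∈ symmetricSubspace p ↔ ∀ A B : Finset (Fin n), A.card = B.card → h A = h B := by
  obtain ⟨P, hP⟩ := Finset.card_eq_one.1 hp
  have hPu : P = Finset.univ := by
    have := p.sup_parts
    rwa [hP, Finset.sup_singleton, id] at this
  subst hPu
  simp [symmetricSubspace, hP]

/-- Summation by parts; the boundary terms vanish in the application, where `f 0 = 0` and `f` is
constant from `N` on. -/
theorem sum_second_difference_mul_min (f : ℕ → ℝ) (j N : ℕ) :
    ∑ m ∈ Finset.range N, ((f (m + 1) - f m) - (f (m + 2) - f (m + 1))) * (min j (m + 1) : ℕ) =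
      f (min j N) - f 0 - (min j N : ℕ) * (f (N + 1) - f N) := by
  induction N with
  | zero => simp
  | succ N ih =>
    rw [Finset.sum_range_succ, ih]
    rcases le_or_gt j N with h | h
    · rw [min_eq_left h, min_eq_left (h.trans N.le_succ)]
      ring
    · rw [min_eq_right h.le, min_eq_right h]
      push_cast
      ring

/-- A symmetric polymatroid is a conic combination of the rank functions of uniform matroids. -/
theorem exists_uniform_decomposition {n : ℕ} {h : EntropySpace n} (hh : h ∈ polymatroidRegion n)
    (hs : ∀ A B : Finset (Fin n), A.card = B.card → h A = h B) :
    ∃ c : Fin n → ℝ, (∀ m, 0 ≤ c m) ∧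
      ∀ A, h A = ∑ m : Fin n, c m * (min A.card (m + 1 : ℕ) : ℕ) := by
  obtain ⟨h0, hmono, hsub⟩ := hh
  let I (k : ℕ) : Finset (Fin n) := Finset.univ.filter fun i => (i : ℕ) < k
  have hI (k : ℕ) : (I k).card = min n k := Fin.card_filter_val_lt
  let f (k : ℕ) : ℝ := h (I k)
  have hf (A : Finset (Fin n)) : h A = f A.card := hs _ _ <| by
    rw [hI, min_eq_right (by simpa using A.card_le_univ)]
  have hf0 : f 0 = 0 := by
    rw [← h0]
    exact hs _ _ (by simp [hI])
  have hfn (k : ℕ) (hk : n ≤ k) : f (k + 1) = f k := hs _ _ <| by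
    rw [hI, hI, min_eq_left hk, min_eq_left (by omega)]
  have hfm (k : ℕ) : f k ≤ f (k + 1) := hmono _ _ fun i => by
    simp only [I, Finset.mem_filter, Finset.mem_univ, true_and]
    omega
  refine ⟨fun m => (f (m + 1) - f m) - (f (m + 2) - f (m + 1)), fun m => ?_, fun A => ?_⟩
  · dsimp only
    -- For `m = n - 1` the second increment is zero and monotonicity suffices; for smaller `m`,
    -- submodularity is applied to two sets of size `m + 1` sharing `m` elements.
    rcases le_or_gt n ((m : ℕ) + 1) with hm | hm
    · have := hfn _ hm
      have := hfm m
      linarith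
    · let k : Fin n := ⟨m + 1, hm⟩
      have hk : k ∉ I m := by simp [I, k, Fin.le_def]
      have hB : h (insert k (I m)) = f (m + 1) := by
        rw [hf, Finset.card_insert_of_notMem hk, hI, min_eq_right (by omega)]
      have hcap : I (m + 1) ∩ insert k (I m) = I m := by
        ext i
        simp only [I, k, Finset.mem_inter, Finset.mem_insert, Finset.mem_filter, Finset.mem_univ,
          true_and, Fin.ext_iff]
        omega
      have hcup : I (m + 1) ∪ insert k (I m) = I (m + 2) := by
        ext i
        simp only [I, k, Finset.mem_union, Finset.mem_insert, Finset.mem_filter, Finset.mem_univ,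
          true_and, Fin.ext_iff]
        omega
      have := hsub (I (m + 1)) (insert k (I m))
      rw [hB, hcap, hcup] at this
      change f m + f (m + 2) ≤ f (m + 1) + f (m + 1) at this
      linarith
  · have := sum_second_difference_mul_min f A.card n
    rw [hfn n le_rfl, hf0, min_eq_left (by simpa using A.card_le_univ), ← hf] at this
    rw [← Fin.sum_univ_eq_sum_range
      (fun m => ((f (m + 1) - f m) - (f (m + 2) - f (m + 1))) * (min A.card (m + 1) : ℕ))] at this
    linarith

/-! ### Approximation by entropy functions and conclusion -/

theorem symPolymatroidRegion_subset_closure {b : ℝ} (hb : 1 < b) {n : ℕ}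
    (p : Finpartition (Finset.univ : Finset (Fin n))) (hp : p.parts.card = 1) :
    symPolymatroidRegion p ⊆ closure (symEntropyRegion b p) := by
  rintro h ⟨hh, hs⟩
  obtain ⟨c, hc0, hc⟩ := exists_uniform_decomposition hh ((mem_symmetricSubspace_iff hp).1 hs)
  choose q hq hqp using Nat.exists_infinite_primes
  have hqlim : Tendsto (fun k => Real.logb b (q k)) atTop atTop :=
    (Real.tendsto_logb_atTop hb).comp
      (tendsto_natCast_atTop_atTop.comp (tendsto_atTop_mono hq tendsto_id))
  have htlim := hqlim.inv_tendsto_atTop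
  -- Here `t` stands for `1 / log q`. At `t = 0` all mass sits on the zero code, and `V` is
  -- continuous there because `x log x` is continuous at 0.
  let δ (t : ℝ) : Fin (n + 1) → ℝ := Fin.cons (1 - t * ∑ m, c m) fun m => t * c m
  let V (t : ℝ) (A : Finset (Fin n)) : ℝ :=
    if A = ∅ then 0 else h A - ∑ m, δ t m * Real.logb b (δ t m)
  have hV0 : V 0 = h := by
    funext A
    simp only [V]
    split_ifs with hA
    · rw [hA, hh.1]
    · simp [Fin.sum_univ_succ, δ]
  have hVc : Continuous V := by
    refine continuous_pi fun A => ?_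
    simp only [V]
    split_ifs
    · exact continuous_const
    refine continuous_const.sub (continuous_finsetSum _ fun m _ => ?_)
    have hδ : Continuous fun t => δ t m := by
      refine Fin.cases ?_ (fun i => ?_) m
      · simp only [δ, Fin.cons_zero]
        fun_prop
      · simp only [δ, Fin.cons_succ]
        fun_prop
    simp only [Real.logb, ← mul_div_assoc]
    exact (Real.continuous_mul_log.comp hδ).div_const _
  have hlim : Tendsto (fun k => V (Real.logb b (q k))⁻¹) atTop (𝓝 h) := by
    rw [← hV0]
    exact (hVc.tendsto 0).comp htlim
  refine mem_closure_of_tendsto hlim ?_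
  -- This keeps the mass left for the zero code nonnegative.
  have hsmall : ∀ᶠ k in atTop, (Real.logb b (q k))⁻¹ * ∑ m, c m < 1 := by
    have := htlim.mul_const (∑ m, c m)
    rw [zero_mul] at this
    exact this.eventually_lt_const one_pos
  filter_upwards [hsmall, eventually_ge_atTop n, hqlim.eventually_gt_atTop 0] with k hk hkn hpos
  constructor
  · have : Fact (q k).Prime := ⟨hqp k⟩
    set t := (Real.logb b (q k))⁻¹ with ht
    have hδ0 (m : Fin (n + 1)) : 0 ≤ δ t m := by
      refine Fin.cases ?_ (fun i => ?_) m
      · simp only [δ, Fin.cons_zero]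
        linarith
      · simp only [δ, Fin.cons_succ]
        exact mul_nonneg (inv_nonneg.2 hpos.le) (hc0 i)
    have hδ1 : ∑ m, δ t m = 1 := by
      simp [δ, Fin.sum_univ_succ, Finset.mul_sum]
    convert mixture_mem_entropyRegion (hkn.trans (hq k)) hb (δ t) hδ0 hδ1 using 1
    funext A
    simp only [V]
    refine if_congr Iff.rfl rfl ?_
    simp only [mul_sub, Finset.sum_sub_distrib]
    congr 1
    rw [hc, Fin.sum_univ_succ]
    simp only [δ, Fin.cons_zero, Fin.cons_succ, Fin.val_zero, Fin.val_succ]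
    simp only [Nat.min_zero, Nat.cast_zero, zero_mul, mul_zero, zero_add]
    refine Finset.sum_congr rfl fun m _ => ?_
    -- The factor `t` in the weights cancels the `log q` of the code entropy.
    rw [ht]
    field_simp
  · rw [mem_symmetricSubspace_iff hp] at hs ⊢
    intro A B hAB
    simp only [V, ← Finset.card_eq_zero, hAB, hs A B hAB]

theorem mainTheorem6 (b : ℝ) (hb : 1 < b) (n : ℕ)
    (p : Finpartition (Finset.univ : Finset (Fin n))) (hp : p.parts.card = 1) :
    symPolymatroidRegion p = closure (entropyRegion b n) ∩ symmetricSubspace p ∧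
      closure (symEntropyRegion b p) = symPolymatroidRegion p := by
  have h1 := symPolymatroidRegion_subset_closure hb p hp
  have h2 : closure (symEntropyRegion b p) ⊆ closure (entropyRegion b n) ∩ symmetricSubspace p :=
    Set.subset_inter (closure_mono Set.inter_subset_left)
      (closure_minimal Set.inter_subset_right (isClosed_symmetricSubspace p))
  have h3 : closure (entropyRegion b n) ∩ symmetricSubspace p ⊆ symPolymatroidRegion p :=
    Set.inter_subset_inter_left _ (closure_minimal (entropyRegion_subset_polymatroidRegion hb n)
      (isClosed_polymatroidRegion n))
  exact ⟨(h1.trans h2).antisymm h3, (h2.trans h3).antisymm h1⟩
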